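/- Let $n,t$ be natural numbers with $t\ge 1$, let $\mathbb R[\bar X]$ be the polynomial ring in $n$ variables $\bar X=(X_1,\dots,X_n)$, and let $\operatorname{Sym}\mathbb R[\bar X]^{t\times t}$ be the real vector space of symmetric $t\times t$ matrices over $\mathbb R[\bar X]$. For $G\subseteq\operatorname{Sym}\mathbb R[\bar X]^{t\times t}$ put $$S_G=\{x\in\mathbb R^n\mid g(x)\text{ is positive semidefinite for all }g\in G\},$$ $$M_G=\Big\{\sum_{i=1}^N p_i^{T}g_ip_i\ \Big|\ N\in\mathbb N,\ g_i\in\{1\}\cup G,\ p_i\in\mathbb R[\bar X]^{t\times t}\Big\}.$$ Call $M_G$ archimedean if for every $a\in\mathbb R[\bar X]^{t\times t}$ there is $N\in\mathbb N$ with $N-a^{T}a\in M_G$. A state on $(\operatorname{Sym}\mathbb R[\bar X]^{t\times t},M_G)$ is a linear form $L:\operatorname{Sym}\mathbb R[\bar X]^{t\times t}\to\mathbb R$ with $L(M_G)\subseteq\mathbb R_{\ge 0}$ and $L(1)=1$; it is pure if it is an extreme point of the convex set of all states. For $0\ne v\in\mathbb R^t$ let $[v]$ denote the line spanned by $v$,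 as a point of the real projective space $\mathbb P^{t-1}(\mathbb R)$. Suppose $G\subseteq\operatorname{Sym}\mathbb R[\bar X]^{t\times t}$ and $M_G$ is archimedean. Then there is a well-defined map that sends $(x,[v])\in S_G\times\mathbb P^{t-1}(\mathbb R)$, where $v$ is a unit vector of $\mathbb R^t$ (for the Euclidean norm), to the linear form $p\mapsto\langle p(x)v,v\rangle$ on $\operatorname{Sym}\mathbb R[\bar X]^{t\times t}$, and this map is a bijection from $S_G\times\mathbb P^{t-1}(\mathbb R)$ onto the set of pure states on $(\operatorname{Sym}\mathbb R[\bar X]^{t\times t},M_G)$. -/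

import Mathlib

open scoped LinearAlgebra.Projectivization

/-- Real `t × t` matrix polynomials in the `n` variables `X₁, …, Xₙ`. -/
abbrev MatPoly (n t : ℕ) : Type := Matrix (Fin t) (Fin t) (MvPolynomial (Fin n) ℝ)

/-- The real vector space of symmetric matrix polynomials (`pᵀ = p`). -/
def SymMatPoly (n t : ℕ) : Submodule ℝ (MatPoly n t) where
  carrier := {p | p.transpose = p}
  add_mem' := by
    intro a b ha hb
    simp only [Set.mem_ofPred_eq] at ha hb ⊢
    rw [Matrix.transpose_add, ha, hb]
  zero_mem' := Matrix.transpose_zero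
  smul_mem' := by
    intro c a ha
    simp only [Set.mem_ofPred_eq] at ha ⊢
    rw [Matrix.transpose_smul, ha]

/-- The identity matrix, as a symmetric matrix polynomial. -/
noncomputable def SymMatPoly.one (n t : ℕ) : SymMatPoly n t := ⟨1, Matrix.transpose_one⟩

/-- The value `p(x)` of a matrix polynomial at a point `x` of `ℝⁿ`. -/
noncomputable def MatPoly.evalAt {n t : ℕ} (x : Fin n → ℝ) (p : MatPoly n t) :
    Matrix (Fin t) (Fin t) ℝ :=
  p.map (MvPolynomial.eval x)

/-- `S_G`: the points of `ℝⁿ` at which every `g ∈ G` is positive semidefinite. -/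
def positivitySet {n t : ℕ} (G : Set (MatPoly n t)) : Set (Fin n → ℝ) :=
  {x | ∀ g ∈ G, (g.evalAt x).PosSemidef}

/-- `M_G`: the quadratic module generated by `G`, that is, the set of all finite sums of
elements `pᵀ g p` with `g ∈ {1} ∪ G` and `p` an arbitrary matrix polynomial. -/
def quadraticModule {n t : ℕ} (G : Set (MatPoly n t)) : Set (MatPoly n t) :=
  {f | ∃ (N : ℕ) (g p : Fin N → MatPoly n t),
    (∀ i, g i ∈ ({1} ∪ G : Set (MatPoly n t))) ∧
      f = ∑ i, (p i).transpose * g i * p i}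

/-- A set `M` of matrix polynomials (meant to be a quadratic module) is archimedean if for every
matrix polynomial `a` there is a natural number `N` with `N - aᵀ a ∈ M`. -/
def IsArchimedean {n t : ℕ} (M : Set (MatPoly n t)) : Prop :=
  ∀ a : MatPoly n t, ∃ N : ℕ, (N : MatPoly n t) - a.transpose * a ∈ M

/-- The set of states on the symmetric matrix polynomials with respect to `M`: real linear forms
that are nonnegative on `M` and take the value `1` at the identity matrix. -/
def states {n t : ℕ} (M : Set (MatPoly n t)) : Set (SymMatPoly n t →ₗ[ℝ] ℝ) :=
  {L | (∀ f : SymMatPoly n t, (f : MatPoly n t) ∈ M → 0 ≤ L f) ∧ L (SymMatPoly.one n t) = 1}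

/-- The pure states: the extreme points of the convex set of all states. -/
def pureStates {n t : ℕ} (M : Set (MatPoly n t)) : Set (SymMatPoly n t →ₗ[ℝ] ℝ) :=
  (states M).extremePoints ℝ

/-!
A state `L` is extended to all matrix polynomials by killing the antisymmetric ones (`symExt`); the
extension obeys the Cauchy–Schwarz inequality with respect to the squares `aᵀ a`.

*Vector states are pure.* If a state `L₁` is a proper convex component of the vector state of
`x` and a unit vector `w`, then `L₁` is dominated by a multiple of it, so by Cauchy–Schwarz `L₁` vanishes on the
left ideal of all `a` with `a(x) w = 0` and on its transpose. Modulo these, every `f` equals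
`(wᵀ f(x) w) P`, where `P` is the constant projection onto `w`; hence `L₁` is the vector state
itself (`eq_vectorState_of_le`).

*Pure states are vector states.* Let `L` be pure. For a polynomial `p`, the form `f ↦ L(p² f)` is
nonnegative on the quadratic module and, by the archimedean property, dominated by a multiple of `L`
(`exists_symExt_sq_smul_le`); purity makes it proportional to `L`. By polarization
`L(p f) = L(p) L(f)` for all polynomials `p` and all `f`, so `L` restricted to scalar matrices is
evaluation at a point `x`, and `L(f) = tr(f(x) ρ)` for a positive semidefinite matrix `ρ` of trace
one. Testing `L` on `aᵀ g a` for a suitable constant `a` of rank one shows that `g(x)` is positive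
semidefinite for `g ∈ G`. Finally, a Schur complement splits a rank-one summand off `ρ`; since `x`
lies in the positivity set, both parts are nonnegative on the quadratic module, and purity forces
`ρ` to be that rank-one part (`eq_vectorState_of_mem_pureStates`).

*Injectivity.* The point is read off from the values at the scalar matrices `Xᵢ`, and the line from
the values at constant projections.
-/

open Matrix

section

variable {n t : ℕ} {G : Set (MatPoly n t)}

/-! ### The quadratic module -/

theorem quadraticModule.add_mem {f g : MatPoly n t} (hf : f ∈ quadraticModule G)
    (hg : g ∈ quadraticModule G) : f + g ∈ quadraticModule G := by
  obtain ⟨N, a, p, ha, rfl⟩ := hf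
  obtain ⟨K, b, q, hb, rfl⟩ := hg
  refine ⟨N + K, Fin.append a b, Fin.append p q, ?_, ?_⟩
  · intro i
    refine Fin.addCases (fun i => ?_) (fun i => ?_) i
    · simpa only [Fin.append_left] using ha i
    · simpa only [Fin.append_right] using hb i
  · simp only [Fin.sum_univ_add, Fin.append_left, Fin.append_right]

theorem quadraticModule.conj_mem {f : MatPoly n t} (hf : f ∈ quadraticModule G)
    (a : MatPoly n t) : aᵀ * f * a ∈ quadraticModule G := by
  obtain ⟨N, g, p, hg, rfl⟩ := hf
  refine ⟨N, g, fun i => p i * a, hg, ?_⟩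
  simp only [Finset.mul_sum, Finset.sum_mul, Matrix.transpose_mul, mul_assoc]

theorem quadraticModule.mem_of_mem_insert {g : MatPoly n t}
    (hg : g ∈ ({1} ∪ G : Set (MatPoly n t))) : g ∈ quadraticModule G :=
  ⟨1, fun _ => g, fun _ => 1, fun _ => hg, by simp⟩

theorem quadraticModule.transpose_mul_self_mem (a : MatPoly n t) :
    aᵀ * a ∈ quadraticModule G := by
  simpa using quadraticModule.conj_mem (G := G) (mem_of_mem_insert (Or.inl rfl)) a

theorem quadraticModule.one_mem : (1 : MatPoly n t) ∈ quadraticModule G :=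
  mem_of_mem_insert (Or.inl rfl)

theorem quadraticModule.sq_smul_mem {f : MatPoly n t} (hf : f ∈ quadraticModule G)
    (p : MvPolynomial (Fin n) ℝ) : p ^ 2 • f ∈ quadraticModule G := by
  simpa [smul_smul, sq] using quadraticModule.conj_mem hf (p • (1 : MatPoly n t))

theorem quadraticModule.smul_mem {f : MatPoly n t} (hf : f ∈ quadraticModule G)
    {c : ℝ} (hc : 0 ≤ c) : c • f ∈ quadraticModule G := by
  have := quadraticModule.conj_mem hf (Real.sqrt c • (1 : MatPoly n t))
  simpa [smul_smul, Real.mul_self_sqrt hc] using this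

theorem quadraticModule.isSymm (hG : ∀ g ∈ G, g ∈ SymMatPoly n t) {f : MatPoly n t}
    (hf : f ∈ quadraticModule G) : f ∈ SymMatPoly n t := by
  obtain ⟨N, g, p, hg, rfl⟩ := hf
  refine Submodule.sum_mem _ fun i _ => ?_
  have : (g i)ᵀ = g i := by
    rcases hg i with h | h
    · rw [Set.mem_singleton_iff.1 h, Matrix.transpose_one]
    · exact hG _ h
  change _ = _
  rw [Matrix.transpose_mul, Matrix.transpose_mul, this, Matrix.transpose_transpose, mul_assoc]

/-! ### Extending linear forms to all matrix polynomials -/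

/-- The symmetric part `(f + fᵀ) / 2` of a matrix polynomial. -/
noncomputable def symPart (n t : ℕ) : MatPoly n t →ₗ[ℝ] SymMatPoly n t where
  toFun f := ⟨(1 / 2 : ℝ) • (f + fᵀ), by
    change _ = _
    rw [Matrix.transpose_smul, Matrix.transpose_add, Matrix.transpose_transpose, add_comm]⟩
  map_add' f g := by
    ext1
    simp only [Matrix.transpose_add, Submodule.coe_add, ← smul_add]
    abel_nf
  map_smul' c f := by
    ext1
    simp only [Matrix.transpose_smul, SetLike.val_smul, ← smul_add, RingHom.id_apply,
      smul_comm c]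

theorem symPart_of_mem {f : MatPoly n t} (hf : f ∈ SymMatPoly n t) :
    symPart n t f = ⟨f, hf⟩ := by
  ext1
  change (1 / 2 : ℝ) • (f + fᵀ) = f
  rw [show fᵀ = f from hf, ← two_smul ℝ f, smul_smul]
  norm_num

theorem symPart_transpose (f : MatPoly n t) : symPart n t fᵀ = symPart n t f := by
  ext1
  change (1 / 2 : ℝ) • (fᵀ + fᵀᵀ) = (1 / 2 : ℝ) • (f + fᵀ)
  rw [Matrix.transpose_transpose, add_comm]

/-- The extension of a linear form from symmetric matrix polynomials to all matrix polynomials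
that vanishes on the antisymmetric ones. Products of symmetric matrices are rarely symmetric, so
the computations with a state take place in this larger algebra. -/
noncomputable def symExt (L : SymMatPoly n t →ₗ[ℝ] ℝ) : MatPoly n t →ₗ[ℝ] ℝ :=
  L ∘ₗ symPart n t

theorem symExt_coe (L : SymMatPoly n t →ₗ[ℝ] ℝ) (f : SymMatPoly n t) :
    symExt L f = L f := by
  rw [symExt, LinearMap.comp_apply, symPart_of_mem f.2]

theorem symExt_transpose (L : SymMatPoly n t →ₗ[ℝ] ℝ) (f : MatPoly n t) :
    symExt L fᵀ = symExt L f := by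
  rw [symExt, LinearMap.comp_apply, symPart_transpose, LinearMap.comp_apply]

theorem symExt_nonneg (hG : ∀ g ∈ G, g ∈ SymMatPoly n t) {L : SymMatPoly n t →ₗ[ℝ] ℝ}
    (hL : ∀ f : SymMatPoly n t, (f : MatPoly n t) ∈ quadraticModule G → 0 ≤ L f)
    {f : MatPoly n t} (hf : f ∈ quadraticModule G) : 0 ≤ symExt L f := by
  rw [symExt, LinearMap.comp_apply, symPart_of_mem (quadraticModule.isSymm hG hf)]
  exact hL _ hf

theorem symExt_one {L : SymMatPoly n t →ₗ[ℝ] ℝ} (h : L (SymMatPoly.one n t) = 1) :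
    symExt L 1 = 1 :=
  (symExt_coe L (SymMatPoly.one n t)).trans h

theorem sq_le_mul_of_forall_quadratic_nonneg {a b c : ℝ}
    (h : ∀ s : ℝ, 0 ≤ a + 2 * b * s + c * s ^ 2) : b ^ 2 ≤ a * c := by
  have := discrim_le_zero (a := c) (b := 2 * b) (c := a) fun s => by nlinarith [h s]
  unfold discrim at this
  nlinarith

/-- The Cauchy–Schwarz inequality for a form that is nonnegative on squares `aᵀ a`. -/
theorem symExt_cauchy_schwarz {L : SymMatPoly n t →ₗ[ℝ] ℝ}
    (hL : ∀ a : MatPoly n t, 0 ≤ symExt L (aᵀ * a)) (a b : MatPoly n t) :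
    symExt L (aᵀ * b) ^ 2 ≤ symExt L (aᵀ * a) * symExt L (bᵀ * b) := by
  refine sq_le_mul_of_forall_quadratic_nonneg fun s => ?_
  have h := hL (a + s • b)
  have hs : symExt L (bᵀ * a) = symExt L (aᵀ * b) := by
    rw [← symExt_transpose, Matrix.transpose_mul, Matrix.transpose_transpose]
  simp only [Matrix.transpose_add, Matrix.transpose_smul, add_mul, mul_add, smul_mul_assoc,
    mul_smul_comm, map_add, map_smul, smul_eq_mul, hs] at h
  linarith

/-! ### Vector states are pure -/

/-- Evaluation of matrix polynomials at `x`, as an algebra homomorphism. -/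
noncomputable def evalHom (t : ℕ) (x : Fin n → ℝ) :
    MatPoly n t →ₐ[ℝ] Matrix (Fin t) (Fin t) ℝ :=
  (MvPolynomial.aeval x).mapMatrix

theorem evalHom_apply (x : Fin n → ℝ) (p : MatPoly n t) : evalHom t x p = p.evalAt x := by
  ext i j
  simp [evalHom, MatPoly.evalAt, MvPolynomial.aeval_eq_eval]

theorem evalHom_transpose (x : Fin n → ℝ) (p : MatPoly n t) :
    evalHom t x pᵀ = (evalHom t x p)ᵀ := rfl

theorem evalHom_smul (x : Fin n → ℝ) (q : MvPolynomial (Fin n) ℝ) (p : MatPoly n t) :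
    evalHom t x (q • p) = MvPolynomial.eval x q • evalHom t x p := by
  ext i j
  simp [evalHom, MvPolynomial.aeval_eq_eval]

theorem posSemidef_evalHom {x : Fin n → ℝ} (hx : x ∈ positivitySet G) {f : MatPoly n t}
    (hf : f ∈ quadraticModule G) : (evalHom t x f).PosSemidef := by
  obtain ⟨N, g, p, hg, rfl⟩ := hf
  simp only [map_sum, map_mul, evalHom_transpose]
  refine Matrix.posSemidef_sum _ fun i _ => ?_
  have h : (evalHom t x (g i)).PosSemidef := by
    rcases hg i with h | h
    · rw [Set.mem_singleton_iff.1 h, map_one]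
      exact Matrix.PosSemidef.one
    · rw [evalHom_apply]
      exact hx _ h
  simpa using h.conjTranspose_mul_mul_same (evalHom t x (p i))

/-- The linear form `p ↦ ⟨p(x) w, w⟩ / ⟨w, w⟩`. The normalization makes it depend only on the
point `x` and the line spanned by `w`. -/
noncomputable def vectorState (x : Fin n → ℝ) (w : Fin t → ℝ) : SymMatPoly n t →ₗ[ℝ] ℝ where
  toFun p := (w ⬝ᵥ w)⁻¹ * (w ⬝ᵥ (evalHom t x p *ᵥ w))
  map_add' p q := by
    simp only [Submodule.coe_add, map_add, Matrix.add_mulVec, dotProduct_add, mul_add]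
  map_smul' c p := by
    simp only [SetLike.val_smul, map_smul, Matrix.smul_mulVec, dotProduct_smul, smul_eq_mul,
      RingHom.id_apply]
    ring

theorem vectorState_apply (x : Fin n → ℝ) (w : Fin t → ℝ) (p : SymMatPoly n t) :
    vectorState x w p = (w ⬝ᵥ w)⁻¹ * (w ⬝ᵥ (evalHom t x p *ᵥ w)) := rfl

theorem vectorState_smul (x : Fin n → ℝ) (w : Fin t → ℝ) {c : ℝ} (hc : c ≠ 0) :
    vectorState x (c • w) = vectorState x w := by
  ext p
  simp only [vectorState_apply, smul_dotProduct, dotProduct_smul, Matrix.mulVec_smul,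
    smul_eq_mul, mul_inv]
  field_simp

theorem vectorState_mem_states {x : Fin n → ℝ} (hx : x ∈ positivitySet G) {w : Fin t → ℝ}
    (hw : w ≠ 0) : vectorState x w ∈ states (quadraticModule G) := by
  constructor
  · intro f hf
    have h := (posSemidef_evalHom hx hf).dotProduct_mulVec_nonneg w
    have h' : 0 ≤ w ⬝ᵥ w := by simpa using dotProduct_star_self_nonneg w
    rw [vectorState_apply]
    exact mul_nonneg (inv_nonneg.2 h') (by simpa using h)
  · rw [vectorState_apply]
    simp only [SymMatPoly.one, map_one, Matrix.one_mulVec]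
    exact inv_mul_cancel₀ (dotProduct_self_eq_zero.not.2 hw)

/-- The constant matrix polynomial with value `A`. -/
noncomputable def constMat (n : ℕ) (A : Matrix (Fin t) (Fin t) ℝ) : MatPoly n t :=
  A.map MvPolynomial.C

theorem constMat_mul (A B : Matrix (Fin t) (Fin t) ℝ) :
    constMat n (A * B) = constMat n A * constMat n B :=
  Matrix.map_mul

theorem constMat_transpose (A : Matrix (Fin t) (Fin t) ℝ) :
    (constMat n A)ᵀ = constMat n Aᵀ := rfl

theorem evalHom_constMat (x : Fin n → ℝ) (A : Matrix (Fin t) (Fin t) ℝ) :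
    evalHom t x (constMat n A) = A := by
  ext i j
  simp [evalHom, constMat]

/-- A form dominated by a vector state vanishes on `b a` whenever `a(x) w = 0`, so compressing by
the projection onto `w` does not change it; the compression of `f` is a polynomial multiple of that
projection, and the polynomial may be replaced by its value at `x`. -/
theorem eq_vectorState_of_le {x : Fin n → ℝ} {w : Fin t → ℝ} (hw : w ⬝ᵥ w = 1)
    {L : SymMatPoly n t →ₗ[ℝ] ℝ} (hL : ∀ a : MatPoly n t, 0 ≤ symExt L (aᵀ * a))
    (h1 : symExt L 1 = 1)
    {c : ℝ} (hle : ∀ a : MatPoly n t, symExt L (aᵀ * a) ≤ c * symExt (vectorState x w) (aᵀ * a)) :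
    L = vectorState x w := by
  have key : ∀ a b : MatPoly n t, evalHom t x a *ᵥ w = 0 → symExt L (b * a) = 0 := by
    intro a b ha
    have h0 : symExt L (aᵀ * a) ≤ 0 := by
      refine (hle a).trans (le_of_eq ?_)
      have hs : aᵀ * a ∈ SymMatPoly n t := by
        change _ = _
        rw [Matrix.transpose_mul, Matrix.transpose_transpose]
      rw [symExt_coe _ ⟨_, hs⟩, vectorState_apply, map_mul, ← Matrix.mulVec_mulVec, ha]
      simp
    have h := symExt_cauchy_schwarz hL bᵀ a
    rw [le_antisymm h0 (hL a), mul_zero, Matrix.transpose_transpose] at h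
    exact pow_eq_zero_iff two_ne_zero |>.1 (le_antisymm h (sq_nonneg _))
  have keyT : ∀ a b : MatPoly n t, evalHom t x a *ᵥ w = 0 → symExt L (aᵀ * b) = 0 := by
    intro a b ha
    rw [← symExt_transpose, Matrix.transpose_mul, Matrix.transpose_transpose]
    exact key a _ ha
  set P : MatPoly n t := constMat n (vecMulVec w w) with hP
  have hPt : Pᵀ = P := by rw [hP, constMat_transpose, transpose_vecMulVec]
  have hPw : evalHom t x P *ᵥ w = w := by
    rw [hP, evalHom_constMat, vecMulVec_mulVec, hw]
    simp
  have hJ : evalHom t x (1 - P) *ᵥ w = 0 := by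
    rw [map_sub, map_one, Matrix.sub_mulVec, hPw, Matrix.one_mulVec, sub_self]
  have hcomp : ∀ f : MatPoly n t, symExt L f = symExt L (P * f * P) := by
    intro f
    have e : f = P * f * P + (P * f * (1 - P) + (1 - P)ᵀ * f) := by
      rw [Matrix.transpose_sub, Matrix.transpose_one, hPt]
      noncomm_ring
    conv_lhs => rw [e]
    rw [map_add, map_add, key _ _ hJ, keyT _ _ hJ, add_zero, add_zero]
  ext f
  set q : MvPolynomial (Fin n) ℝ :=
    (fun i => MvPolynomial.C (w i)) ⬝ᵥ ((f : MatPoly n t) *ᵥ fun i => MvPolynomial.C (w i)) with hq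
  have hPfP : P * f * P = q • P := by
    have hv : P = vecMulVec (fun i => MvPolynomial.C (w i)) (fun i => MvPolynomial.C (w i)) := by
      ext1 i j
      simp [hP, constMat, vecMulVec_apply]
    rw [mul_assoc, hv, mul_vecMulVec, vecMulVec_mul_vecMulVec, ← hq, vecMulVec_smul]
  have hqx : MvPolynomial.eval x q = w ⬝ᵥ (evalHom t x f *ᵥ w) := by
    simp [hq, dotProduct, Matrix.mulVec, evalHom, MvPolynomial.aeval_eq_eval]
  have hz : symExt L (q • P) = MvPolynomial.eval x q * symExt L P := by
    have h := key ((q - MvPolynomial.C (MvPolynomial.eval x q)) • P) 1 (by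
      rw [evalHom_smul]; simp)
    rw [one_mul, sub_smul, map_sub, sub_eq_zero] at h
    rw [h, ← smul_eq_mul, ← map_smul]
    congr 1
    ext1 i j
    simp [MvPolynomial.smul_eq_C_mul]
  have hP1 : symExt L P = 1 := by
    have h := hcomp 1
    rw [h1, mul_one, hP, ← constMat_mul, vecMulVec_mul_vecMulVec, hw, one_smul] at h
    exact h.symm
  rw [← symExt_coe, hcomp, hPfP, hz, hP1, vectorState_apply, hw, hqx]
  simp

theorem vectorState_mem_pureStates (hG : ∀ g ∈ G, g ∈ SymMatPoly n t) {x : Fin n → ℝ}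
    (hx : x ∈ positivitySet G) {w : Fin t → ℝ} (hw : w ⬝ᵥ w = 1) :
    vectorState x w ∈ pureStates (quadraticModule G) := by
  have hw0 : w ≠ 0 := by
    rintro rfl
    simp at hw
  refine mem_extremePoints_iff_left.2 ⟨vectorState_mem_states hx hw0, ?_⟩
  rintro L₁ ⟨h₁, h₁'⟩ L₂ ⟨h₂, h₂'⟩ ⟨a, b, ha, hb, hab, h⟩
  refine eq_vectorState_of_le hw (c := a⁻¹)
    (fun f => symExt_nonneg hG h₁ (quadraticModule.transpose_mul_self_mem f)) (symExt_one h₁')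
    fun f => ?_
  have h₂f := symExt_nonneg hG h₂ (quadraticModule.transpose_mul_self_mem f)
  have e : symExt (vectorState x w) (fᵀ * f) =
      a * symExt L₁ (fᵀ * f) + b * symExt L₂ (fᵀ * f) := by
    rw [← h]; rfl
  rw [e, mul_add, inv_mul_cancel_left₀ ha.ne']
  have : 0 ≤ a⁻¹ * (b * symExt L₂ (fᵀ * f)) := by positivity
  linarith

/-! ### Domination by a pure state -/

/-- The archimedean property bounds every symmetric `f`, not only squares:
`4 f = (1 + f)² - (1 - f)²`. -/
theorem exists_smul_one_sub_mem (harch : IsArchimedean (quadraticModule G))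
    (f : SymMatPoly n t) :
    ∃ c : ℝ, 0 ≤ c ∧ c • (1 : MatPoly n t) - f ∈ quadraticModule G := by
  obtain ⟨N, hN⟩ := harch (1 + f)
  refine ⟨N / 4, by positivity, ?_⟩
  have hf : (f : MatPoly n t)ᵀ = f := f.2
  have h := quadraticModule.smul_mem (quadraticModule.add_mem hN
    (quadraticModule.transpose_mul_self_mem (1 - (f : MatPoly n t)))) (c := 1 / 4) (by norm_num)
  convert h using 1
  have e : (N : MatPoly n t) - (1 + (f : MatPoly n t))ᵀ * (1 + (f : MatPoly n t)) +
      (1 - (f : MatPoly n t))ᵀ * (1 - (f : MatPoly n t)) =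
        (N : MatPoly n t) - (4 : ℝ) • (f : MatPoly n t) := by
    rw [Matrix.transpose_add, Matrix.transpose_sub, Matrix.transpose_one, hf,
      show (4 : ℝ) • (f : MatPoly n t) = (4 : ℕ) • (f : MatPoly n t) by
        rw [← Nat.cast_smul_eq_nsmul ℝ]; norm_num]
    noncomm_ring
  rw [e, smul_sub, smul_smul, div_eq_inv_mul, mul_smul, Nat.cast_smul_eq_nsmul, nsmul_one]
  norm_num

theorem eq_zero_of_nonneg_of_one (harch : IsArchimedean (quadraticModule G))
    {F : SymMatPoly n t →ₗ[ℝ] ℝ}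
    (hF : ∀ f : SymMatPoly n t, (f : MatPoly n t) ∈ quadraticModule G → 0 ≤ F f)
    (h1 : F (SymMatPoly.one n t) = 0) : F = 0 := by
  have key : ∀ f, F f ≤ 0 := by
    intro f
    obtain ⟨c, -, hc⟩ := exists_smul_one_sub_mem harch f
    have h := hF (c • SymMatPoly.one n t - f) hc
    rw [map_sub, map_smul, h1, smul_zero] at h
    linarith
  refine LinearMap.ext fun f => le_antisymm (key f) ?_
  have h := key (-f)
  rwa [map_neg, neg_nonpos] at h

theorem smul_mem_states {F : SymMatPoly n t →ₗ[ℝ] ℝ}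
    (hF : ∀ f : SymMatPoly n t, (f : MatPoly n t) ∈ quadraticModule G → 0 ≤ F f)
    (h1 : 0 < F (SymMatPoly.one n t)) :
    (F (SymMatPoly.one n t))⁻¹ • F ∈ states (quadraticModule G) :=
  ⟨fun f hf => mul_nonneg (inv_nonneg.2 h1.le) (hF f hf), inv_mul_cancel₀ h1.ne'⟩

/-- Purity of a state in its usual order-theoretic form. The archimedean property handles the case
in which one of the two summands `F` and `c L - F` vanishes at `1`. -/
theorem eq_smul_of_mem_pureStates (harch : IsArchimedean (quadraticModule G))
    {L : SymMatPoly n t →ₗ[ℝ] ℝ} (hL : L ∈ pureStates (quadraticModule G))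
    {F : SymMatPoly n t →ₗ[ℝ] ℝ} {c : ℝ} (hc : 0 < c)
    (hF : ∀ f : SymMatPoly n t, (f : MatPoly n t) ∈ quadraticModule G → 0 ≤ F f)
    (hle : ∀ f : SymMatPoly n t, (f : MatPoly n t) ∈ quadraticModule G → F f ≤ c * L f) :
    F = F (SymMatPoly.one n t) • L := by
  have h1 : L (SymMatPoly.one n t) = 1 := hL.1.2
  set K := c • L - F with hKdef
  have hK : ∀ f : SymMatPoly n t, (f : MatPoly n t) ∈ quadraticModule G → 0 ≤ K f :=
    fun f hf => sub_nonneg.2 (hle f hf)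
  have hK1 : K (SymMatPoly.one n t) = c - F (SymMatPoly.one n t) := by
    simp [hKdef, h1]
  rcases (hF (SymMatPoly.one n t) quadraticModule.one_mem).eq_or_lt with h0 | h0
  · rw [← h0, zero_smul]
    exact eq_zero_of_nonneg_of_one harch hF h0.symm
  rcases (hK (SymMatPoly.one n t) quadraticModule.one_mem).eq_or_lt with k0 | k0
  · have hKz := eq_zero_of_nonneg_of_one harch hK k0.symm
    rw [← sub_eq_zero.1 (hK1.symm.trans k0.symm)]
    exact (sub_eq_zero.1 hKz).symm
  have hmem := (mem_extremePoints_iff_left.1 hL).2 _ (smul_mem_states hF h0) _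
    (smul_mem_states hK k0) ⟨F (SymMatPoly.one n t) / c, K (SymMatPoly.one n t) / c,
      div_pos h0 hc, div_pos k0 hc, by rw [hK1]; field_simp; ring, by
        rw [smul_smul, smul_smul, div_mul_eq_mul_div, div_mul_eq_mul_div,
          mul_inv_cancel₀ h0.ne', mul_inv_cancel₀ k0.ne', ← smul_add, hKdef, add_sub_cancel,
          smul_smul, one_div, inv_mul_cancel₀ hc.ne', one_smul]⟩
  conv_rhs => rw [← hmem]
  rw [smul_smul, mul_inv_cancel₀ h0.ne', one_smul]

/-! ### Multiplicativity on the centre -/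

/-- If `a 0 > m N`, then iterating `a k ^ 2 ≤ m a (k + 1)` makes `a k` grow like `(N r) ^ 2 ^ k`
with `r > 1`, faster than the upper bound permits. -/
theorem le_mul_of_sq_le_of_le_pow {a : ℕ → ℝ} {m C N : ℝ} (hm : 0 ≤ m) (hN : 0 < N)
    (hsq : ∀ k, a k ^ 2 ≤ m * a (k + 1)) (hbd : ∀ k, a k ≤ C * N ^ 2 ^ k) : a 0 ≤ m * N := by
  rcases hm.eq_or_lt with rfl | hm
  · have h := hsq 0
    rw [zero_mul] at h
    rw [zero_mul]
    exact (pow_eq_zero_iff two_ne_zero |>.1 (le_antisymm h (sq_nonneg _))).le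
  by_contra! hlt
  have ha : 0 < a 0 := lt_trans (by positivity) hlt
  set r := a 0 / (m * N) with hr
  have hr1 : 1 < r := by rwa [hr, one_lt_div (by positivity)]
  have key : ∀ k, m * (N * r) ^ 2 ^ k ≤ a k := by
    intro k
    induction k with
    | zero => rw [hr, pow_zero, pow_one]; apply le_of_eq; field_simp
    | succ k ih =>
      have h := (pow_le_pow_left₀ (by positivity) ih 2).trans (hsq k)
      rw [mul_pow, ← pow_mul, ← pow_succ, sq, mul_assoc] at h
      exact le_of_mul_le_mul_left h hm
  obtain ⟨k, hk⟩ := pow_unbounded_of_one_lt (C / m) hr1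
  have h1 : r ^ k ≤ r ^ 2 ^ k := pow_le_pow_right₀ hr1.le Nat.lt_two_pow_self.le
  have h2 := (key k).trans (hbd k)
  rw [mul_pow, mul_left_comm, mul_comm C, mul_le_mul_iff_right₀ (by positivity)] at h2
  rw [div_lt_iff₀ hm] at hk
  nlinarith

/-- Multiplication by `p²` is a bounded operation with respect to a state `L`, although
`(N - p²) f` need not lie in the quadratic module when `N - p²` and `f` do. The numbers
`φ(q) = L(q f)` satisfy `φ(q)² ≤ φ(1) φ(q²)`, and `φ(p²ᵏ)` grows at most like `Nᵏ`, which
together force `φ(p²) ≤ N φ(1)`. -/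
theorem exists_symExt_sq_smul_le (hG : ∀ g ∈ G, g ∈ SymMatPoly n t)
    (harch : IsArchimedean (quadraticModule G)) {L : SymMatPoly n t →ₗ[ℝ] ℝ}
    (hL : L ∈ states (quadraticModule G)) (p : MvPolynomial (Fin n) ℝ) :
    ∃ N : ℝ, 0 < N ∧ ∀ f ∈ quadraticModule G,
      symExt L (p ^ 2 • f) ≤ N * symExt L f := by
  obtain ⟨N, hN⟩ := harch (p • 1)
  have hpos : ∀ {f}, f ∈ quadraticModule G → 0 ≤ symExt L f := symExt_nonneg hG hL.1
  refine ⟨N + 1, by positivity, fun f hf => ?_⟩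
  obtain ⟨C, hC0, hC⟩ := exists_smul_one_sub_mem harch ⟨f, quadraticModule.isSymm hG hf⟩
  have hpow : ∀ k : ℕ, symExt L ((p ^ k) ^ 2 • 1) ≤ (N + 1 : ℝ) ^ k := by
    intro k
    induction k with
    | zero => simp [symExt_one hL.2]
    | succ k ih =>
      have h := hpos (quadraticModule.sq_smul_mem hN (p ^ k))
      have h' := hpos (quadraticModule.sq_smul_mem (G := G) quadraticModule.one_mem (p ^ k))
      have e : (p ^ k) ^ 2 • ((N : MatPoly n t) - (p • (1 : MatPoly n t))ᵀ * (p • 1)) =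
          (N : ℝ) • ((p ^ k) ^ 2 • (1 : MatPoly n t)) - (p ^ (k + 1)) ^ 2 • 1 := by
        rw [smul_sub, Matrix.transpose_smul, Matrix.transpose_one, smul_mul_smul_comm, one_mul,
          smul_smul, smul_comm, Nat.cast_smul_eq_nsmul, nsmul_one]
        congr 2
        ring
      rw [e, map_sub, map_smul, smul_eq_mul] at h
      rw [pow_succ (N + 1 : ℝ)]
      have hN1 : (0 : ℝ) ≤ N + 1 := by positivity
      nlinarith [mul_le_mul_of_nonneg_right ih hN1]
  have h := le_mul_of_sq_le_of_le_pow (a := fun k => symExt L (p ^ 2 ^ (k + 1) • f))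
    (m := symExt L f) (C := C) (N := N + 1) (hpos hf) (by positivity) (fun k => ?_) fun k => ?_
  · simpa [mul_comm] using h
  · refine sq_le_mul_of_forall_quadratic_nonneg fun s => ?_
    have h := hpos (quadraticModule.sq_smul_mem hf (1 + MvPolynomial.C s * p ^ 2 ^ (k + 1)))
    have e : (1 + MvPolynomial.C s * p ^ 2 ^ (k + 1)) ^ 2 • f =
        f + (2 * s) • (p ^ 2 ^ (k + 1) • f) + s ^ 2 • (p ^ 2 ^ (k + 1 + 1) • f) := by
      simp only [← algebraMap_smul (MvPolynomial (Fin n) ℝ) (2 * s),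
        ← algebraMap_smul (MvPolynomial (Fin n) ℝ) (s ^ 2), smul_smul, MvPolynomial.algebraMap_eq]
      nth_rw 2 [← one_smul (MvPolynomial (Fin n) ℝ) f]
      rw [← add_smul, ← add_smul]
      congr 1
      simp only [map_mul, map_pow, map_ofNat, pow_succ 2 (k + 1), pow_mul]
      ring
    rw [e, map_add, map_add, map_smul _ (2 * s), map_smul _ (s ^ 2), smul_eq_mul, smul_eq_mul] at h
    linarith
  · have h := hpos (quadraticModule.sq_smul_mem hC (p ^ 2 ^ k))
    have hk := mul_le_mul_of_nonneg_left (hpow (2 ^ k)) hC0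
    rw [smul_sub, smul_comm, map_sub, map_smul, smul_eq_mul] at h
    rw [pow_succ 2 k, pow_mul p]
    linarith

/-- A pure state is multiplicative with respect to the centre of the matrix algebra. -/
theorem symExt_smul_of_mem_pureStates (hG : ∀ g ∈ G, g ∈ SymMatPoly n t)
    (harch : IsArchimedean (quadraticModule G)) {L : SymMatPoly n t →ₗ[ℝ] ℝ}
    (hL : L ∈ pureStates (quadraticModule G)) (p : MvPolynomial (Fin n) ℝ) (f : MatPoly n t) :
    symExt L (p • f) = symExt L (p • 1) * symExt L f := by
  have hsq : ∀ (q : MvPolynomial (Fin n) ℝ) (f : SymMatPoly n t),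
      symExt L (q ^ 2 • (f : MatPoly n t)) = symExt L (q ^ 2 • 1) * symExt L f := by
    intro q f
    obtain ⟨N, hN0, hN⟩ := exists_symExt_sq_smul_le hG harch hL.1 q
    have h := eq_smul_of_mem_pureStates harch hL
      (F := symExt L ∘ₗ Algebra.lsmul ℝ ℝ (MatPoly n t) (q ^ 2) ∘ₗ (SymMatPoly n t).subtype) hN0
      (fun f hf => symExt_nonneg hG hL.1.1 (quadraticModule.sq_smul_mem hf q))
      (fun f hf => (hN f hf).trans_eq (by rw [symExt_coe]))
    have h' := LinearMap.congr_fun h f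
    rw [symExt_coe]
    exact h'
  -- Every polynomial is a difference of two squares.
  have hsym : ∀ f : SymMatPoly n t,
      symExt L (p • (f : MatPoly n t)) = symExt L (p • 1) * symExt L f := by
    have hpol : ∀ f : MatPoly n t, symExt L (p • f) = (1 / 4 : ℝ) *
        (symExt L ((p + 1) ^ 2 • f) - symExt L ((p - 1) ^ 2 • f)) := by
      intro f
      rw [← map_sub, ← sub_smul, ← smul_eq_mul, ← map_smul,
        show (p + 1) ^ 2 - (p - 1) ^ 2 = MvPolynomial.C 4 * p by
          rw [map_ofNat]; ring, mul_smul, ← MvPolynomial.algebraMap_eq, algebraMap_smul, smul_smul]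
      norm_num
    intro f
    rw [hpol f, hpol 1, hsq, hsq]
    ring
  have h := hsym ⟨f + fᵀ, by
    change _ = _
    rw [Matrix.transpose_add, Matrix.transpose_transpose, add_comm]⟩
  have e : symExt L (p • fᵀ) = symExt L (p • f) := by
    rw [← Matrix.transpose_smul, symExt_transpose]
  simp only [smul_add, map_add, e, symExt_transpose] at h
  linarith

/-- The point of `ℝⁿ` at which a pure state is concentrated: its coordinates are the values of the
state at the scalar matrices `Xᵢ`. -/
noncomputable def statePoint (L : SymMatPoly n t →ₗ[ℝ] ℝ) : Fin n → ℝ :=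
  fun i => symExt L ((MvPolynomial.X i : MvPolynomial (Fin n) ℝ) • 1)

theorem symExt_smul_one (hG : ∀ g ∈ G, g ∈ SymMatPoly n t)
    (harch : IsArchimedean (quadraticModule G)) {L : SymMatPoly n t →ₗ[ℝ] ℝ}
    (hL : L ∈ pureStates (quadraticModule G)) (p : MvPolynomial (Fin n) ℝ) :
    symExt L (p • 1) = MvPolynomial.eval (statePoint L) p := by
  induction p using MvPolynomial.induction_on with
  | C a =>
    rw [← MvPolynomial.algebraMap_eq, algebraMap_smul, map_smul, symExt_one hL.1.2]
    simp
  | add p q hp hq => rw [add_smul, map_add, map_add, hp, hq]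
  | mul_X p i hp =>
    rw [mul_smul, symExt_smul_of_mem_pureStates hG harch hL, hp, map_mul, MvPolynomial.eval_X]
    rfl

/-! ### The density matrix of a pure state -/

/-- The matrix `ρ` of a state on the constant matrices, so that `L(A) = tr(A ρ)` for constant `A`. -/
noncomputable def densityMatrix (L : SymMatPoly n t →ₗ[ℝ] ℝ) : Matrix (Fin t) (Fin t) ℝ :=
  Matrix.of fun i j => symExt L (Matrix.single i j 1)

theorem densityMatrix_transpose (L : SymMatPoly n t →ₗ[ℝ] ℝ) :
    (densityMatrix L)ᵀ = densityMatrix L := by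
  ext i j
  simp only [densityMatrix, Matrix.transpose_apply, Matrix.of_apply]
  rw [← symExt_transpose, Matrix.transpose_single]

theorem symExt_eq_trace (hG : ∀ g ∈ G, g ∈ SymMatPoly n t)
    (harch : IsArchimedean (quadraticModule G)) {L : SymMatPoly n t →ₗ[ℝ] ℝ}
    (hL : L ∈ pureStates (quadraticModule G)) (f : MatPoly n t) :
    symExt L f = (evalHom t (statePoint L) f * densityMatrix L).trace := by
  have e : f = ∑ i, ∑ j, f i j • Matrix.single i j (1 : MvPolynomial (Fin n) ℝ) := by
    simpa only [Matrix.smul_single, smul_eq_mul, mul_one] using Matrix.matrix_eq_sum_single f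
  have hE : ∀ i j, symExt L (f i j • Matrix.single i j 1) =
      MvPolynomial.eval (statePoint L) (f i j) * symExt L (Matrix.single i j 1) := fun i j => by
    rw [symExt_smul_of_mem_pureStates hG harch hL, symExt_smul_one hG harch hL]
  conv_lhs => rw [e]
  rw [← densityMatrix_transpose]
  simp only [map_sum, hE, Matrix.trace, Matrix.diag, Matrix.mul_apply,
    Matrix.transpose_apply]
  simp [evalHom, densityMatrix, MvPolynomial.aeval_eq_eval]

theorem symExt_constMat_vecMulVec (hG : ∀ g ∈ G, g ∈ SymMatPoly n t)
    (harch : IsArchimedean (quadraticModule G)) {L : SymMatPoly n t →ₗ[ℝ] ℝ}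
    (hL : L ∈ pureStates (quadraticModule G)) (u w : Fin t → ℝ) :
    symExt L (constMat n (vecMulVec u w)) = u ⬝ᵥ (densityMatrix L *ᵥ w) := by
  rw [symExt_eq_trace hG harch hL, evalHom_constMat, Matrix.vecMulVec_mul, Matrix.trace_vecMulVec,
    ← Matrix.mulVec_transpose, densityMatrix_transpose]

/-- The density matrix has trace one and nonnegative diagonal entries. -/
theorem exists_densityMatrix_diag_pos (hG : ∀ g ∈ G, g ∈ SymMatPoly n t)
    (harch : IsArchimedean (quadraticModule G)) {L : SymMatPoly n t →ₗ[ℝ] ℝ}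
    (hL : L ∈ pureStates (quadraticModule G)) : ∃ i, 0 < densityMatrix L i i := by
  have h := symExt_eq_trace hG harch hL 1
  rw [symExt_one hL.1.2, map_one, one_mul] at h
  obtain ⟨i, -, hi⟩ := Finset.exists_lt_of_sum_lt (s := Finset.univ) (f := fun _ => (0 : ℝ))
    (g := fun i => densityMatrix L i i) (by
      rw [Finset.sum_const_zero]
      exact zero_lt_one.trans_eq h)
  exact ⟨i, hi⟩

theorem statePoint_mem_positivitySet (hG : ∀ g ∈ G, g ∈ SymMatPoly n t)
    (harch : IsArchimedean (quadraticModule G)) {L : SymMatPoly n t →ₗ[ℝ] ℝ}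
    (hL : L ∈ pureStates (quadraticModule G)) : statePoint L ∈ positivitySet G := by
  obtain ⟨i, hi⟩ := exists_densityMatrix_diag_pos hG harch hL
  intro g hg
  rw [← evalHom_apply]
  have hs : (evalHom t (statePoint L) g)ᵀ = evalHom t (statePoint L) g := by
    rw [← evalHom_transpose, show gᵀ = g from hG g hg]
  refine Matrix.PosSemidef.of_dotProduct_mulVec_nonneg
    (by rwa [Matrix.IsHermitian, Matrix.conjTranspose_eq_transpose_of_trivial]) fun w => ?_
  -- For `a = w eᵢᵀ` the state takes the value `(wᵀ g(x) w) ρᵢᵢ` at `aᵀ g a`.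
  have h := symExt_nonneg hG hL.1.1 (quadraticModule.conj_mem
    (quadraticModule.mem_of_mem_insert (Or.inr hg)) (constMat n (vecMulVec w (Pi.single i 1))))
  rw [symExt_eq_trace hG harch hL, map_mul, map_mul, evalHom_transpose, evalHom_constMat,
    transpose_vecMulVec, vecMulVec_mul, vecMulVec_mul_vecMulVec, vecMulVec_mul, trace_vecMulVec,
    smul_vecMul, dotProduct_smul, ← dotProduct_mulVec] at h
  simp only [single_one_vecMul, single_one_dotProduct, smul_eq_mul] at h
  exact nonneg_of_mul_nonneg_left h hi

/-- The Schur complement of a positive diagonal entry of the density matrix, padded by zeros. -/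
theorem posSemidef_densityMatrix_sub (hG : ∀ g ∈ G, g ∈ SymMatPoly n t)
    (harch : IsArchimedean (quadraticModule G)) {L : SymMatPoly n t →ₗ[ℝ] ℝ}
    (hL : L ∈ pureStates (quadraticModule G)) {i : Fin t} (hi : 0 < densityMatrix L i i) :
    (densityMatrix L - (densityMatrix L i i)⁻¹ •
      vecMulVec (densityMatrix L i) (densityMatrix L i)).PosSemidef := by
  refine Matrix.PosSemidef.of_dotProduct_mulVec_nonneg ?_ fun w => ?_
  · rw [Matrix.IsHermitian, Matrix.conjTranspose_eq_transpose_of_trivial, Matrix.transpose_sub,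
      Matrix.transpose_smul, transpose_vecMulVec, densityMatrix_transpose]
  have h := symExt_cauchy_schwarz
    (fun a => symExt_nonneg hG hL.1.1 (quadraticModule.transpose_mul_self_mem a))
    (constMat n (vecMulVec (Pi.single i 1) (Pi.single i 1)))
    (constMat n (vecMulVec (Pi.single i 1) w))
  simp only [constMat_transpose, transpose_vecMulVec, ← constMat_mul, vecMulVec_mul_vecMulVec,
    single_one_dotProduct, Pi.single_eq_same, one_smul,
    symExt_constMat_vecMulVec hG harch hL, mulVec_single_one] at h
  simp only [Matrix.col_apply] at h
  have hw : w ⬝ᵥ densityMatrix L i = densityMatrix L i ⬝ᵥ w := dotProduct_comm _ _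
  rw [star_trivial, Matrix.sub_mulVec, Matrix.smul_mulVec, vecMulVec_mulVec, op_smul_eq_smul,
    dotProduct_sub, dotProduct_smul, dotProduct_smul, smul_eq_mul, smul_eq_mul, hw, ← sq,
    sub_nonneg, inv_mul_le_iff₀ hi]
  exact h

/-- The density matrix `ρ` of a pure state has rank one: for a positive diagonal entry `ρᵢᵢ` and
the `i`-th row `u`, both `u uᵀ / ρᵢᵢ` and its complement in `ρ` are positive semidefinite, so the
vector state of `u` is proportional to the given one. -/
theorem eq_vectorState_of_mem_pureStates (hG : ∀ g ∈ G, g ∈ SymMatPoly n t)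
    (harch : IsArchimedean (quadraticModule G)) {L : SymMatPoly n t →ₗ[ℝ] ℝ}
    (hL : L ∈ pureStates (quadraticModule G)) :
    ∃ w : Fin t → ℝ, w ≠ 0 ∧ L = vectorState (statePoint L) w := by
  obtain ⟨i, hi⟩ := exists_densityMatrix_diag_pos hG harch hL
  have hx := statePoint_mem_positivitySet hG harch hL
  set u := densityMatrix L i with hu
  have hu0 : u ≠ 0 := fun h => hi.ne' (congrFun h i)
  have hpos : 0 < u ⬝ᵥ u := by simpa using dotProduct_star_self_pos_iff.2 hu0
  have hS := vectorState_mem_states hx hu0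
  have h := eq_smul_of_mem_pureStates harch hL (F := vectorState (statePoint L) u)
    (c := u i * (u ⬝ᵥ u)⁻¹) (mul_pos hi (inv_pos.2 hpos)) hS.1 fun f hf => ?_
  · rw [hS.2, one_smul] at h
    exact ⟨u, hu0, h.symm⟩
  have hf0 := posSemidef_evalHom hx hf
  set A := evalHom t (statePoint L) f with hA
  have hσ := posSemidef_densityMatrix_sub hG harch hL hi
  have htr : 0 ≤ (A * (densityMatrix L - (u i)⁻¹ • vecMulVec u u)).trace := by
    obtain ⟨m, B, hB⟩ := Matrix.posSemidef_iff_eq_sum_vecMulVec.1 hf0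
    rw [hB, Finset.sum_mul, Matrix.trace_sum]
    refine Finset.sum_nonneg fun k _ => ?_
    rw [vecMulVec_mul, trace_vecMulVec, dotProduct_comm, ← dotProduct_mulVec]
    exact hσ.dotProduct_mulVec_nonneg (B k)
  rw [mul_sub, Matrix.trace_sub, ← symExt_eq_trace hG harch hL, symExt_coe, mul_smul_comm,
    Matrix.trace_smul, mul_vecMulVec, trace_vecMulVec, dotProduct_comm, smul_eq_mul, sub_nonneg,
    inv_mul_le_iff₀ hi] at htr
  rw [vectorState_apply, mul_comm (u i), mul_assoc]
  exact mul_le_mul_of_nonneg_left htr (inv_nonneg.2 hpos.le)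

/-! ### The parametrization -/

theorem vectorState_smul_one (x : Fin n → ℝ) {w : Fin t → ℝ} (hw : w ≠ 0)
    (q : MvPolynomial (Fin n) ℝ) :
    symExt (vectorState x w) (q • 1) = MvPolynomial.eval x q := by
  have hs : q • (1 : MatPoly n t) ∈ SymMatPoly n t := by
    change _ = _
    rw [Matrix.transpose_smul, Matrix.transpose_one]
  rw [symExt_coe _ ⟨_, hs⟩, vectorState_apply]
  simp only [evalHom_smul, map_one, Matrix.smul_mulVec, Matrix.one_mulVec, dotProduct_smul,
    smul_eq_mul]
  rw [mul_comm, mul_assoc, mul_inv_cancel₀ (dotProduct_self_eq_zero.not.2 hw), mul_one]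

/-- The line is recovered by testing against the constant projection onto `v`: equality holds in
the Cauchy–Schwarz inequality for `v` and `w`. -/
theorem exists_smul_eq_of_vectorState_eq {x : Fin n → ℝ} {v w : Fin t → ℝ} (hv : v ≠ 0)
    (hw : w ≠ 0) (h : vectorState x v = vectorState x w) : ∃ c : ℝ, c • w = v := by
  have hv' : v ⬝ᵥ v ≠ 0 := dotProduct_self_eq_zero.not.2 hv
  have hw' : w ⬝ᵥ w ≠ 0 := dotProduct_self_eq_zero.not.2 hw
  have h1 := LinearMap.congr_fun h ⟨constMat n (vecMulVec v v), by
    change _ = _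
    rw [constMat_transpose, transpose_vecMulVec]⟩
  simp only [vectorState_apply, evalHom_constMat, vecMulVec_mulVec, op_smul_eq_smul,
    dotProduct_smul, smul_eq_mul] at h1
  rw [inv_mul_cancel_left₀ hv', dotProduct_comm w v] at h1
  refine ⟨(v ⬝ᵥ w) * (w ⬝ᵥ w)⁻¹, (sub_eq_zero.1 (dotProduct_self_eq_zero.1 ?_)).symm⟩
  simp only [dotProduct_sub, sub_dotProduct, dotProduct_smul, smul_dotProduct, smul_eq_mul,
    dotProduct_comm w v, h1]
  field_simp
  ring

end

theorem corollary11 (n t : ℕ) (G : Set (MatPoly n t))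
    (hG : ∀ g ∈ G, g ∈ SymMatPoly n t)
    (harch : IsArchimedean (quadraticModule G)) :
    ∃ Φ : positivitySet G × ℙ ℝ (EuclideanSpace ℝ (Fin t)) → pureStates (quadraticModule G),
      (∀ (x : positivitySet G) (v : EuclideanSpace ℝ (Fin t)) (hv : v ≠ 0), ‖v‖ = 1 →
        ∀ p : SymMatPoly n t,
          (Φ (x, Projectivization.mk ℝ v hv) : SymMatPoly n t →ₗ[ℝ] ℝ) p =
            inner ℝ (Matrix.toEuclideanLin (MatPoly.evalAt (x : Fin n → ℝ) (p : MatPoly n t)) v)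
              v) ∧
      Function.Bijective Φ := by
  have hne : ∀ v : EuclideanSpace ℝ (Fin t), v ≠ 0 → v.ofLp ≠ 0 := fun v hv h =>
    hv ((WithLp.ofLp_eq_zero 2).1 h)
  have hnorm : ∀ v : EuclideanSpace ℝ (Fin t), ‖v‖ = 1 → v.ofLp ⬝ᵥ v.ofLp = 1 := by
    intro v hv
    have h := EuclideanSpace.real_norm_sq_eq v
    rw [hv, one_pow] at h
    rw [h]
    exact Finset.sum_congr rfl fun i _ => (sq _).symm
  have hwd : ∀ (x : Fin n → ℝ) (v w : EuclideanSpace ℝ (Fin t)) (hv : v ≠ 0) (hw : w ≠ 0),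
      Projectivization.mk ℝ v hv = Projectivization.mk ℝ w hw →
      vectorState (n := n) x v.ofLp = vectorState x w.ofLp := by
    intro x v w hv hw h
    obtain ⟨a, ha⟩ := (Projectivization.mk_eq_mk_iff ℝ v w hv hw).1 h
    rw [← ha]
    exact vectorState_smul x w.ofLp a.ne_zero
  have hunit : ∀ q : ℙ ℝ (EuclideanSpace ℝ (Fin t)),
      ∃ (v : EuclideanSpace ℝ (Fin t)) (hv : v ≠ 0), ‖v‖ = 1 ∧ q = Projectivization.mk ℝ v hv := by
    intro q
    have h0 : ‖q.rep‖ ≠ 0 := norm_ne_zero_iff.2 q.rep_nonzero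
    refine ⟨‖q.rep‖⁻¹ • q.rep, smul_ne_zero (inv_ne_zero h0) q.rep_nonzero, ?_, ?_⟩
    · rw [norm_smul, norm_inv, norm_norm, inv_mul_cancel₀ h0]
    · conv_lhs => rw [← q.mk_rep]
      exact (Projectivization.mk_eq_mk_iff' ℝ _ _ _ _).2 ⟨‖q.rep‖, smul_inv_smul₀ h0 _⟩
  have hpure : ∀ (x : positivitySet G) (q : ℙ ℝ (EuclideanSpace ℝ (Fin t))),
      vectorState (x : Fin n → ℝ) q.rep.ofLp ∈ pureStates (quadraticModule G) := by
    intro x q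
    obtain ⟨v, hv, hv1, hq⟩ := hunit q
    rw [hwd x q.rep v q.rep_nonzero hv (q.mk_rep.trans hq)]
    exact vectorState_mem_pureStates hG x.2 (hnorm v hv1)
  refine ⟨fun y => ⟨vectorState (y.1 : Fin n → ℝ) y.2.rep.ofLp, hpure y.1 y.2⟩, ?_, ?_, ?_⟩
  · intro x v hv hv1 p
    change vectorState (x : Fin n → ℝ) _ p = _
    rw [hwd x _ v (Projectivization.rep_nonzero _) hv (Projectivization.mk_rep _),
      vectorState_apply, hnorm v hv1, inv_one, one_mul, evalHom_apply,
      EuclideanSpace.inner_eq_star_dotProduct, star_trivial]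
    rfl
  · rintro ⟨x, q⟩ ⟨y, r⟩ h
    have h' : vectorState (x : Fin n → ℝ) q.rep.ofLp = vectorState (y : Fin n → ℝ) r.rep.ofLp :=
      congrArg Subtype.val h
    have hq := hne _ q.rep_nonzero
    have hr := hne _ r.rep_nonzero
    have hxy : x = y := by
      ext i
      have hi := vectorState_smul_one (x : Fin n → ℝ) hq (MvPolynomial.X i)
      rw [h', vectorState_smul_one _ hr] at hi
      simpa using hi.symm
    subst hxy
    obtain ⟨c, hc⟩ := exists_smul_eq_of_vectorState_eq hq hr h'
    have hqr : q = r := by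
      rw [← q.mk_rep, ← r.mk_rep]
      exact (Projectivization.mk_eq_mk_iff' ℝ _ _ _ _).2 ⟨c, WithLp.ofLp_injective 2 hc⟩
    rw [hqr]
  · rintro ⟨L, hL⟩
    obtain ⟨w, hw, hLw⟩ := eq_vectorState_of_mem_pureStates hG harch hL
    have hw' : WithLp.toLp 2 w ≠ 0 := fun h => hw ((WithLp.toLp_eq_zero 2).1 h)
    refine ⟨(⟨statePoint L, statePoint_mem_positivitySet hG harch hL⟩,
      Projectivization.mk ℝ (WithLp.toLp 2 w) hw'), Subtype.ext ?_⟩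
    exact (hwd _ _ _ (Projectivization.rep_nonzero _) hw' (Projectivization.mk_rep _)).trans
      hLw.symm
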